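/- **Setting.** Let $T$ be a tree (a connected graph without cycles), possibly with vertices of infinite degree, in which every vertex has degree $\ge 3$. Let $P=(p(x,y))_{x,y\in T}$ be the transition matrix of a nearest neighbour random walk on $T$: $p(x,y)\ge 0$, $\sum_y p(x,y)=1$ for every $x$, and $p(x,y)>0$ if and only if $x$ and $y$ are neighbours. Write $p^{(n)}(x,y)$ for the entries of $P^n$. Choose a root $o\in T$ and set $$\rho=\limsup_{n\to\infty}p^{(n)}(o,o)^{1/n},\qquad m(x)=\prod_{i=1}^{k}\frac{p(x_{i-1},x_i)}{p(x_i,x_{i-1})},$$ where $[o=x_0,x_1,\dots,x_k=x]$ is the geodesic from $o$ to $x$. By $Pf(x)=\sum_y p(x,y)f(y)$, $P$ acts as a bounded self-adjoint operator on the complex Hilbert space $\ell^2(T,m)$. For $\lambda$ in its resolvent set, the Green function is $G(x,y|\lambda)=\bigl((\lambda I-P)^{-1}\mathbf 1_{y}\bigr)(x)$. Let $\Gamma$ be a group of automorphisms of $T$ which acts transitively on the vertices and satisfies $p(\gamma x,\gamma y)=p(x,y)$ for all $\gamma\in\Gamma$ and $x,y\in T$. Let $I$ be the set of orbits of $\Gamma$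 on the oriented edges of $T$. If $j\in I$ is the orbit (type) of the edge $(x,y)$, write $p_j=p(x,y)$, let $-j$ be the orbit of $(y,x)$, and let $d_j$ be the (finite) number of neighbours $y$ of a given vertex $x$ such that $(x,y)$ has type $j$; these do not depend on the choices. Assume that $\sum_{j\in I}d_j\,p_{-j}<\infty$ (which is automatic when $I$ is finite). **Proposition.** The maximum $\kappa=\max\{2\sqrt{p_jp_{-j}}:j\in I\}$ exists. Let $$\mathcal U=\{\lambda\in\mathbb C:|\lambda|>\rho\}\setminus\{\pm i\,t: t\in\mathbb R,\ \rho<t\le\kappa\}$$ (nothing is removed when $\kappa\le\rho$). Let $\lambda\in\mathcal U$. Then $\lambda$ belongs to the resolvent set of $P$ on $\ell^2(T,m)$; the number $G(\lambda)=G(x,x|\lambda)$ is the same for all vertices $x$; the number $G_j(\lambda)=G(x,y|\lambda)$ is the same for all oriented edges $(x,y)$ of type $j$; and for every $j\in I$, $$1+4p_jp_{-j}\,G(\lambda)^2\in\mathbb C\setminus(-\infty,0]\qquad\text{and}\qquad G_j(\lambda)=\frac{1}{2p_{-j}}\Bigl(\sqrt{1+4p_jp_{-j}\,G(\lambda)^2}-1\Bigr),$$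 where the square root is the principal branch on $\mathbb C\setminus(-\infty,0]$, $\sqrt{re^{i\theta}}=\sqrt r\,e^{i\theta/2}$ for $r>0$, $-\pi<\theta<\pi$. -/

import Mathlib

open MeasureTheory

noncomputable section

/-- A nearest neighbour random walk on a tree with a chosen root: `p x y` is the probability of a
step from `x` to `y`, the rows of `p` sum to `1`, and `p x y > 0` exactly when `x` and `y` are
neighbours. Vertices may have infinite degree. -/
structure TreeWalk (V : Type*) where
  /-- the tree -/
  tree : SimpleGraph V
  isTree : tree.IsTree
  /-- the reference vertex -/
  root : V
  /-- the transition probabilities -/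
  p : V → V → ℝ
  p_nonneg : ∀ x y, 0 ≤ p x y
  p_pos_iff : ∀ x y, 0 < p x y ↔ tree.Adj x y
  hasSum_p : ∀ x, HasSum (p x) 1

namespace TreeWalk

variable {V : Type*} (W : TreeWalk V)

open Classical in
/-- The `n`-step transition probabilities: `p⁽ⁿ⁾(x,y)` is the `(x,y)`-entry of the `n`-th power of
the transition matrix. -/
def stepProb : ℕ → V → V → ℝ
  | 0, x, y => if x = y then 1 else 0
  | n + 1, x, y => ∑' w, W.p x w * stepProb n w y

/-- The spectral radius `ρ = limsup p⁽ⁿ⁾(x,y)^(1/n)`, taken at `x = y = root`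
(the number is the same for all `x` and `y`). -/
def rho : ℝ :=
  Filter.limsup (fun n : ℕ => W.stepProb n W.root W.root ^ (1 / (n : ℝ))) Filter.atTop

/-- The geodesic from the root to `x`. -/
def geodesic (x : V) : W.tree.Walk W.root x :=
  (W.isTree.existsUnique_path W.root x).choose

/-- The product of the quotients `p(a,b) / p(b,a)` over the steps `(a,b)` of a walk in the tree. -/
def walkWeight {x y : V} (q : W.tree.Walk x y) : ℝ :=
  (q.darts.map fun e => W.p e.fst e.snd / W.p e.snd e.fst).prod

/-- The reversing measure `m(x) = ∏ p(xᵢ₋₁,xᵢ) / p(xᵢ,xᵢ₋₁)` along the geodesic from the root. -/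
def m (x : V) : ℝ := W.walkWeight (W.geodesic x)

theorem p_pos {x y : V} (h : W.tree.Adj x y) : 0 < W.p x y := (W.p_pos_iff x y).2 h

theorem p_eq_zero {x y : V} (h : ¬ W.tree.Adj x y) : W.p x y = 0 :=
  le_antisymm (not_lt.1 fun h' => h ((W.p_pos_iff x y).1 h')) (W.p_nonneg x y)

theorem geodesic_isPath (x : V) : (W.geodesic x).IsPath :=
  (W.isTree.existsUnique_path W.root x).choose_spec.1

theorem geodesic_unique {x : V} (q : W.tree.Walk W.root x) (hq : q.IsPath) : q = W.geodesic x :=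
  (W.isTree.existsUnique_path W.root x).choose_spec.2 q hq

theorem m_pos (x : V) : 0 < W.m x := by
  refine List.prod_pos ?_
  intro a ha
  obtain ⟨e, -, rfl⟩ := List.mem_map.1 ha
  exact div_pos (W.p_pos e.adj) (W.p_pos e.adj.symm)

theorem m_concat {x y : V} (h : W.tree.Adj x y) (hy : y ∉ (W.geodesic x).support) :
    W.m x * W.p x y = W.m y * W.p y x := by
  have h1 : (W.geodesic x).concat h = W.geodesic y :=
    W.geodesic_unique _ ((W.geodesic_isPath x).concat hy h)
  have h2 : W.m y = W.m x * (W.p x y / W.p y x) := by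
    simp only [m, walkWeight]
    rw [← h1, SimpleGraph.Walk.darts_concat]
    simp
  rw [h2, mul_assoc, div_mul_cancel₀ _ (W.p_pos h.symm).ne']

/-- Reversibility. -/
theorem m_mul_p (x y : V) : W.m x * W.p x y = W.m y * W.p y x := by
  by_cases h : W.tree.Adj x y
  · by_cases hy : y ∈ (W.geodesic x).support
    · have hx : x ∉ (W.geodesic y).support :=
        W.isTree.isAcyclic.ne_mem_support_of_support_of_adj_of_isPath
          (W.geodesic_isPath x) (W.geodesic_isPath y) h hy
      exact (W.m_concat h.symm hx).symm
    · exact W.m_concat h hy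
  · rw [W.p_eq_zero h, W.p_eq_zero fun h' => h h'.symm, mul_zero, mul_zero]

/-- `m` as a measure on the discrete space of vertices. -/
def measure : @Measure V ⊤ :=
  @Measure.sum V V ⊤ fun x => ENNReal.ofReal (W.m x) • @Measure.dirac V ⊤ x

/-- The complex Hilbert space `ℓ²(T, m)`. -/
abbrev ell2 : Type _ := Lp ℂ 2 W.measure

theorem lintegral_measure (f : V → ENNReal) :
    @lintegral V ⊤ W.measure f = ∑' x, ENNReal.ofReal (W.m x) * f x := by
  let _ : MeasurableSpace V := ⊤
  rw [measure, lintegral_sum_measure]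
  simp only [lintegral_smul_measure, lintegral_dirac, smul_eq_mul]

theorem ofReal_m_ne_zero (x : V) : ENNReal.ofReal (W.m x) ≠ 0 := by
  simpa using W.m_pos x

theorem measure_singleton (x : V) : W.measure {x} = ENNReal.ofReal (W.m x) := by
  let _ : MeasurableSpace V := ⊤
  have hs : MeasurableSet ({x} : Set V) := trivial
  classical
  rw [← lintegral_indicator_one hs, W.lintegral_measure, tsum_eq_single x]
  · simp
  · intro y hy
    simp [hy]

/-- Every vertex has positive mass, so elements of `ℓ²(T, m)` are honest functions. -/
theorem eq_of_ae {α : Type*} {f g : V → α}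
    (h : f =ᵐ[W.measure] g) : f = g := by
  let _ : MeasurableSpace V := ⊤
  funext x
  by_contra hx
  have h0 : W.measure {x} = 0 := measure_mono_null (by simpa using hx) (ae_iff.1 h)
  exact W.ofReal_m_ne_zero x (by rw [← W.measure_singleton, h0])

theorem tsum_ofReal_p (x : V) : ∑' y, ENNReal.ofReal (W.p x y) = 1 := by
  rw [← ENNReal.ofReal_tsum_of_nonneg (W.p_nonneg x) (W.hasSum_p x).summable,
    (W.hasSum_p x).tsum_eq, ENNReal.ofReal_one]

theorem jensen (x : V) (f : V → ENNReal) :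
    (∑' y, ENNReal.ofReal (W.p x y) * f y) ^ (2 : ℝ)
      ≤ ∑' y, ENNReal.ofReal (W.p x y) * f y ^ (2 : ℝ) := by
  let _ : MeasurableSpace V := ⊤
  let ν : Measure V := Measure.sum fun y => ENNReal.ofReal (W.p x y) • Measure.dirac y
  have hν : ∀ g : V → ENNReal, ∫⁻ y, g y ∂ν = ∑' y, ENNReal.ofReal (W.p x y) * g y := by
    intro g
    simp only [ν, lintegral_sum_measure, lintegral_smul_measure, lintegral_dirac, smul_eq_mul]
  have h := ENNReal.lintegral_mul_le_Lp_mul_Lq ν Real.HolderConjugate.two_two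
    (f := f) (g := fun _ => 1) measurable_from_top.aemeasurable measurable_from_top.aemeasurable
  have h1 : ∫⁻ y, (fun _ => (1 : ENNReal)) y ^ (2 : ℝ) ∂ν = 1 := by
    rw [hν]
    simpa using W.tsum_ofReal_p x
  rw [h1] at h
  simp only [Pi.mul_apply, mul_one, ENNReal.one_rpow, hν] at h
  calc _ ≤ ((∑' y, ENNReal.ofReal (W.p x y) * f y ^ (2 : ℝ)) ^ (1 / (2 : ℝ))) ^ (2 : ℝ) :=
        ENNReal.rpow_le_rpow h (by norm_num)
    _ = _ := by rw [← ENNReal.rpow_mul]; norm_num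

/-- The transition operator on functions, `Pf(x) = ∑ p(x,y) f(y)`. -/
def act (f : V → ℂ) (x : V) : ℂ := ∑' y, (W.p x y : ℂ) * f y

theorem enorm_p_mul (f : V → ℂ) (x y : V) :
    ‖(W.p x y : ℂ) * f y‖ₑ = ENNReal.ofReal (W.p x y) * ‖f y‖ₑ := by
  rw [enorm_mul]
  congr 1
  rw [← ofReal_norm, Complex.norm_real, Real.norm_of_nonneg (W.p_nonneg x y)]

theorem lintegral_jensen (f : V → ENNReal) :
    ∑' x, ENNReal.ofReal (W.m x) * (∑' y, ENNReal.ofReal (W.p x y) * f y) ^ (2 : ℝ)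
      ≤ ∑' x, ENNReal.ofReal (W.m x) * f x ^ (2 : ℝ) := by
  have hrev : ∀ x y, ENNReal.ofReal (W.m x) * ENNReal.ofReal (W.p x y)
      = ENNReal.ofReal (W.m y) * ENNReal.ofReal (W.p y x) := by
    intro x y
    rw [← ENNReal.ofReal_mul (W.m_pos x).le, ← ENNReal.ofReal_mul (W.m_pos y).le, W.m_mul_p]
  calc _ ≤ ∑' x, ENNReal.ofReal (W.m x) * ∑' y, ENNReal.ofReal (W.p x y) * f y ^ (2 : ℝ) :=
        ENNReal.tsum_le_tsum fun x => by gcongr; exact W.jensen x f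
    _ = ∑' x, ∑' y, ENNReal.ofReal (W.m x) * ENNReal.ofReal (W.p x y) * f y ^ (2 : ℝ) := by
        simp only [← ENNReal.tsum_mul_left, mul_assoc]
    _ = ∑' y, ∑' x, ENNReal.ofReal (W.m x) * ENNReal.ofReal (W.p x y) * f y ^ (2 : ℝ) :=
        ENNReal.tsum_comm
    _ = ∑' y, ENNReal.ofReal (W.m y) * f y ^ (2 : ℝ) * ∑' x, ENNReal.ofReal (W.p y x) := by
        simp only [← ENNReal.tsum_mul_left]
        refine tsum_congr fun y => tsum_congr fun x => ?_
        rw [hrev]; ring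
    _ = _ := by simp only [W.tsum_ofReal_p, mul_one]

theorem eLpNorm_eq (f : V → ℂ) : eLpNorm f 2 W.measure
    = (∑' x, ENNReal.ofReal (W.m x) * ‖f x‖ₑ ^ (2 : ℝ)) ^ (1 / (2 : ℝ)) := by
  let _ : MeasurableSpace V := ⊤
  rw [eLpNorm_eq_lintegral_rpow_enorm_toReal two_ne_zero ENNReal.ofNat_ne_top,
    W.lintegral_measure]
  simp

theorem eLpNorm_act_le (f : V → ℂ) :
    eLpNorm (W.act f) 2 W.measure ≤ eLpNorm f 2 W.measure := by
  rw [W.eLpNorm_eq, W.eLpNorm_eq]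
  refine ENNReal.rpow_le_rpow (le_trans ?_ (W.lintegral_jensen fun x => ‖f x‖ₑ)) (by norm_num)
  refine ENNReal.tsum_le_tsum fun x => ?_
  gcongr
  refine enorm_tsum_le_tsum_enorm.trans ?_
  simp only [W.enorm_p_mul, le_refl]

theorem memLp_act (f : W.ell2) : MemLp (W.act f) 2 W.measure := by
  let _ : MeasurableSpace V := ⊤
  exact ⟨(measurable_from_top (f := W.act f)).aestronglyMeasurable,
    (W.eLpNorm_act_le f).trans_lt (Lp.memLp f).2⟩

/-- The series defining `Pf(x)` converges absolutely for `f` in `ℓ²(T, m)`. -/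
theorem summable_act (f : W.ell2) (x : V) : Summable fun y => (W.p x y : ℂ) * f y := by
  let _ : MeasurableSpace V := ⊤
  have h : (∑' x, ENNReal.ofReal (W.m x) * ‖f x‖ₑ ^ (2 : ℝ)) ≠ ⊤ := by
    intro h
    have h2 := (Lp.memLp f).2
    rw [W.eLpNorm_eq, h] at h2
    simp at h2
  have h1 : ENNReal.ofReal (W.m x) * (∑' y, ENNReal.ofReal (W.p x y) * ‖f y‖ₑ) ^ (2 : ℝ) ≠ ⊤ :=
    ne_top_of_le_ne_top h
      ((ENNReal.le_tsum x).trans (W.lintegral_jensen fun x => ‖f x‖ₑ))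
  have h2 : (∑' y, ENNReal.ofReal (W.p x y) * ‖f y‖ₑ) ≠ ⊤ := by
    intro h3
    rw [h3] at h1
    refine h1 ?_
    rw [ENNReal.top_rpow_of_pos (by norm_num), ENNReal.mul_top (W.ofReal_m_ne_zero x)]
  refine Summable.of_enorm ?_
  simpa only [W.enorm_p_mul] using h2

/-- The transition operator `P` on `ℓ²(T, m)`. -/
def P : W.ell2 →L[ℂ] W.ell2 :=
  LinearMap.mkContinuous
    { toFun := fun f => (W.memLp_act f).toLp (W.act f)
      map_add' := by
        intro f g
        rw [← MemLp.toLp_add]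
        congr 1
        have hfg : ((f + g : W.ell2) : V → ℂ) = f + g := W.eq_of_ae (Lp.coeFn_add f g)
        funext x
        simp only [act, hfg, Pi.add_apply, mul_add]
        exact (W.summable_act f x).tsum_add (W.summable_act g x)
      map_smul' := by
        intro c f
        rw [RingHom.id_apply, ← MemLp.toLp_const_smul]
        congr 1
        have hcf : ((c • f : W.ell2) : V → ℂ) = c • (f : V → ℂ) :=
          W.eq_of_ae (Lp.coeFn_smul c f)
        funext x
        simp only [act, hcf, Pi.smul_apply, smul_eq_mul, mul_left_comm _ c, tsum_mul_left] }
    1 (by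
      intro f
      rw [one_mul]
      change ‖(W.memLp_act f).toLp (W.act f)‖ ≤ ‖f‖
      rw [Lp.norm_toLp, Lp.norm_def]
      exact ENNReal.toReal_mono (Lp.memLp f).2.ne (W.eLpNorm_act_le f))

/-- `P` is given by the transition matrix. -/
theorem P_apply (f : W.ell2) (x : V) : W.P f x = ∑' y, (W.p x y : ℂ) * f y :=
  congrFun (W.eq_of_ae (MemLp.coeFn_toLp (W.memLp_act f))) x

theorem measure_singleton_ne_top (x : V) : W.measure {x} ≠ ⊤ := by
  rw [W.measure_singleton]; exact ENNReal.ofReal_ne_top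

/-- The indicator function of the vertex `y`, as an element of `ℓ²(T, m)`. -/
def indicator (y : V) : W.ell2 :=
  @indicatorConstLp V ℂ ⊤ W.measure _ {y} 2 trivial (W.measure_singleton_ne_top y) 1

open Classical in
theorem indicator_apply (x y : V) : W.indicator y x = if x = y then 1 else 0 := by
  have h := congrFun (W.eq_of_ae
    (@indicatorConstLp_coeFn V ℂ ⊤ 2 W.measure _ {y} trivial (W.measure_singleton_ne_top y) 1)) x
  exact h.trans (by simp [Set.indicator_apply])

/-- The resolvent set of `P` on `ℓ²(T, m)`. -/
def res : Set ℂ := resolventSet ℂ W.P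

/-- The Green function `G(x,y|λ)`: the value at `x` of `(λ - P)⁻¹` applied to the indicator
function of `y`. It is meaningful for `λ` in the resolvent set. -/
def G (x y : V) (z : ℂ) : ℂ := (resolvent W.P z (W.indicator y) : W.ell2) x

/-- The transition probabilities are invariant under `Γ`, and `Γ` is transitive on the vertices. -/
structure IsTransitivelyInvariant (Γ : Subgroup (W.tree ≃g W.tree)) : Prop where
  transitive : ∀ x y, ∃ γ ∈ Γ, γ x = y
  invariant : ∀ γ ∈ Γ, ∀ x y, W.p (γ x) (γ y) = W.p x y

variable (Γ : Subgroup (W.tree ≃g W.tree))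

/-- Two oriented edges are equivalent if some element of `Γ` maps one to the other. -/
def edgeSetoid : Setoid W.tree.Dart where
  r e e' := ∃ γ ∈ Γ, γ e.fst = e'.fst ∧ γ e.snd = e'.snd
  iseqv :=
    { refl := fun _ => ⟨1, Γ.one_mem, rfl, rfl⟩
      symm := by
        rintro e e' ⟨γ, hγ, h1, h2⟩
        refine ⟨γ⁻¹, Γ.inv_mem hγ, ?_, ?_⟩
        · rw [← h1]; exact γ.symm_apply_apply _
        · rw [← h2]; exact γ.symm_apply_apply _
      trans := by
        rintro e e' e'' ⟨γ, hγ, h1, h2⟩ ⟨γ', hγ', h1', h2'⟩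
        refine ⟨γ' * γ, Γ.mul_mem hγ' hγ, ?_, ?_⟩
        · rw [← h1', ← h1]; rfl
        · rw [← h2', ← h2]; rfl }

/-- The set `I` of edge types: the orbits of `Γ` on the oriented edges. -/
def EdgeType : Type _ := Quotient (W.edgeSetoid Γ)

variable {W Γ}

/-- The type of an oriented edge. -/
def edgeType (Γ : Subgroup (W.tree ≃g W.tree)) (e : W.tree.Dart) : W.EdgeType Γ :=
  Quotient.mk (W.edgeSetoid Γ) e

/-- The involution `j ↦ -j` on edge types, induced by reversing the orientation of edges. -/
def EdgeType.neg : W.EdgeType Γ → W.EdgeType Γ :=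
  Quotient.map (sa := W.edgeSetoid Γ) (sb := W.edgeSetoid Γ) SimpleGraph.Dart.symm
    fun _ _ ⟨γ, hγ, h1, h2⟩ => ⟨γ, hγ, h2, h1⟩

/-- `p_j = p(x,y)` for any edge `(x,y)` of type `j`. -/
def EdgeType.prob (hΓ : W.IsTransitivelyInvariant Γ) : W.EdgeType Γ → ℝ :=
  Quotient.lift (s := W.edgeSetoid Γ) (fun e => W.p e.fst e.snd) (by
    rintro e e' ⟨γ, hγ, h1, h2⟩
    rw [← h1, ← h2, hΓ.invariant γ hγ])

/-- `d_j`: the number of neighbours `y` of the root `x` for which `(x,y)` has type `j`.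
(By transitivity every vertex `x` gives the same number, and it is finite.) -/
def EdgeType.mult (j : W.EdgeType Γ) : ℕ :=
  Set.ncard {e : W.tree.Dart | e.fst = W.root ∧ edgeType Γ e = j}

/-- `κ = max {2 √(p_j p_{-j}) : j ∈ I}`. -/
def kappa (hΓ : W.IsTransitivelyInvariant Γ) : ℝ :=
  ⨆ j : W.EdgeType Γ, 2 * √(j.prob hΓ * j.neg.prob hΓ)

/-- The set `𝒰 = {λ ∈ ℂ : |λ| > ρ} \ {± i t : ρ < t ≤ κ}`. -/
def regionU (hΓ : W.IsTransitivelyInvariant Γ) : Set ℂ :=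
  {z | W.rho < ‖z‖} \
    {z | ∃ t : ℝ, W.rho < t ∧ t ≤ kappa hΓ ∧ (z = Complex.I * t ∨ z = -(Complex.I * t))}

end TreeWalk

end

/-! ### Symmetric operators on an inner product space. -/

section SelfAdjoint

open Filter
open scoped InnerProductSpace

variable {H : Type*} [NormedAddCommGroup H] [InnerProductSpace ℂ H]

/-! Cutting the tree at an edge `xy` gives `p(y,x) G(x,y)² + G(x,y) = p(x,y) G(x,x) G(y,y)`
(`G_adj_quadratic`). Homogeneity makes the diagonal constant, and completing the square turns this
into `(1 + 2 p_{-j} G_j)² = 1 + 4 p_j p_{-j} G²`. Only the sign of the root remains to be found.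

At infinity `1 + 2 p_{-j} G_j` tends to `1`, so the sign is principal there. It stays principal
along the ray `s z`, `s ≥ 1`, as long as `1 + 4 p_j p_{-j} G²` avoids `(-∞,0]`
(`one_add_mul_G_sq_mem_slitPlane`). Off the imaginary axis this holds because `Re G ≠ 0`: with `u =
(z² - P²)⁻¹ 1ₓ`, `m(x) Re G = Re z · (|z|²‖u‖² - ‖Pu‖²)`. On the axis `|G| ≤ 1/|z|`, which suffices
when `|z| > κ`; this is why only segments of that axis are removed.

All of this takes place where `|z| > ‖P‖`. The bound `‖P‖ ≤ ρ` comes from return probabilities at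
the root, through log-convexity of `‖Pⁿ f‖`. The maximum `κ` exists because `p_j → 0` along the
types. -/

/-- The norms `‖T ^ n f‖` form a log-convex sequence when `T` is symmetric. -/
theorem LinearMap.IsSymmetric.norm_pow_succ_sq_le {T : H →L[ℂ] H}
    (hT : (T : H →ₗ[ℂ] H).IsSymmetric) (f : H) (n : ℕ) :
    ‖(T ^ (n + 1)) f‖ ^ 2 ≤ ‖(T ^ n) f‖ * ‖(T ^ (n + 2)) f‖ := by
  have h1 : (T ^ (n + 1)) f = T ((T ^ n) f) := by rw [pow_succ']; rfl
  have h2 : (T ^ (n + 2)) f = T (T ((T ^ n) f)) := by rw [pow_succ', pow_succ']; rfl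
  have h3 : ⟪T ((T ^ n) f), T ((T ^ n) f)⟫_ℂ = ⟪(T ^ n) f, T (T ((T ^ n) f))⟫_ℂ := hT _ _
  rw [h1, h2, ← inner_self_eq_norm_sq (𝕜 := ℂ), h3]
  exact re_inner_le_norm _ _

/-- Log-convexity makes the ratios of consecutive norms nondecreasing; cross-multiplied, so that
vanishing norms are allowed. -/
theorem LinearMap.IsSymmetric.norm_apply_mul_norm_pow_le {T : H →L[ℂ] H}
    (hT : (T : H →ₗ[ℂ] H).IsSymmetric) (f : H) (n : ℕ) :
    ‖T f‖ * ‖(T ^ n) f‖ ≤ ‖f‖ * ‖(T ^ (n + 1)) f‖ := by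
  induction n with
  | zero => simp [mul_comm]
  | succ n ih =>
    have h := hT.norm_pow_succ_sq_le f n
    rcases (norm_nonneg ((T ^ (n + 1)) f)).eq_or_lt with h0 | h0
    · rw [← h0, mul_zero]; positivity
    · refine le_of_mul_le_mul_right ?_ h0
      nlinarith [mul_le_mul_of_nonneg_right ih (norm_nonneg ((T ^ (n + 2)) f)),
        mul_le_mul_of_nonneg_left h (norm_nonneg (T f))]

/-- A symmetric operator is bounded on a vector by the exponential growth rate of its orbit. -/
theorem LinearMap.IsSymmetric.norm_apply_le_of_eventually {T : H →L[ℂ] H}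
    (hT : (T : H →ₗ[ℂ] H).IsSymmetric) {f : H} {r C : ℝ} (hr : 0 < r)
    (hC : ∀ᶠ n : ℕ in atTop, ‖(T ^ n) f‖ ≤ C * r ^ n) : ‖T f‖ ≤ r * ‖f‖ := by
  by_contra! hlt
  have hf : 0 < ‖f‖ := by
    rw [norm_pos_iff]; rintro rfl; simp at hlt
  -- The first ratio is the smallest, so the orbit grows at least geometrically with it; a first
  -- ratio above `r` would beat `C * r ^ n`, whatever `C` is.
  have hgrow : ∀ n : ℕ, ‖f‖ * (‖T f‖ / ‖f‖) ^ n ≤ ‖(T ^ n) f‖ := by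
    intro n
    induction n with
    | zero => simp
    | succ n ih =>
      have h := hT.norm_apply_mul_norm_pow_le f n
      calc _ = ‖T f‖ / ‖f‖ * (‖f‖ * (‖T f‖ / ‖f‖) ^ n) := by ring
        _ ≤ ‖T f‖ / ‖f‖ * ‖(T ^ n) f‖ := by gcongr
        _ ≤ _ := by rw [div_mul_eq_mul_div, div_le_iff₀ hf]; linarith
  have hq : 1 < ‖T f‖ / ‖f‖ / r := by
    rw [lt_div_iff₀ hr, lt_div_iff₀ hf]; linarith
  have ht := (tendsto_pow_atTop_atTop_of_one_lt hq).eventually_gt_atTop (C / ‖f‖)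
  obtain ⟨n, h1, h2⟩ := (hC.and ht).exists
  have h3 := (hgrow n).trans h1
  rw [div_lt_iff₀ hf, div_pow, div_mul_eq_mul_div, lt_div_iff₀ (by positivity)] at h2
  linarith

/-- Symmetry turns `⟪T²u, u⟫` into `‖Tu‖²`. Meant for `u = (z² - T²)⁻¹ f`, where the left side is
`⟪f, z u⟫`. -/
theorem LinearMap.IsSymmetric.inner_sq_sub_sq {T : H →L[ℂ] H}
    (hT : (T : H →ₗ[ℂ] H).IsSymmetric) (z : ℂ) (u : H) :
    ⟪z ^ 2 • u - T (T u), z • u⟫_ℂ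
      = z * ((starRingEnd ℂ z) ^ 2 * (‖u‖ : ℂ) ^ 2 - (‖T u‖ : ℂ) ^ 2) := by
  have h : ⟪T (T u), u⟫_ℂ = ⟪T u, T u⟫_ℂ := hT _ _
  rw [inner_smul_right, inner_sub_left, inner_smul_left, h, inner_self_eq_norm_sq_to_K,
    inner_self_eq_norm_sq_to_K, map_pow]
  rfl

/-- Since `⟪v, T v⟫` is real, the cross term with `i t` has real part zero and Pythagoras applies.
-/
theorem LinearMap.IsSymmetric.norm_smul_sub_sq {T : H →L[ℂ] H}
    (hT : (T : H →ₗ[ℂ] H).IsSymmetric) (t : ℝ) (v : H) :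
    t ^ 2 * ‖v‖ ^ 2 ≤ ‖(Complex.I * t) • v - T v‖ ^ 2 := by
  have h : RCLike.re ⟪(Complex.I * t) • v, T v⟫_ℂ = 0 := by
    have h1 : (starRingEnd ℂ) ⟪v, T v⟫_ℂ = ⟪v, T v⟫_ℂ := by
      rw [inner_conj_symm]; exact hT v v
    have h2 := Complex.conj_eq_iff_im.1 h1
    simp [h2]
  rw [norm_sub_sq (𝕜 := ℂ), h, norm_smul, mul_pow]
  simp

end SelfAdjoint

/-! ### The operator `P`: symmetry, powers and the bound `‖P‖ ≤ ρ`. -/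

noncomputable section
namespace TreeWalk
open scoped InnerProductSpace
open Filter

variable {V : Type*} (W : TreeWalk V)

theorem coe_sub (f g : W.ell2) : ((f - g : W.ell2) : V → ℂ) = f - g :=
  W.eq_of_ae (Lp.coeFn_sub f g)

theorem coe_smul (c : ℂ) (f : W.ell2) : ((c • f : W.ell2) : V → ℂ) = c • (f : V → ℂ) :=
  W.eq_of_ae (Lp.coeFn_smul c f)

theorem coe_zero : ((0 : W.ell2) : V → ℂ) = 0 :=
  W.eq_of_ae (Lp.coeFn_zero ℂ 2 W.measure)

theorem ext {f g : W.ell2} (h : ∀ x, f x = g x) : f = g :=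
  Lp.ext (Eventually.of_forall h)

theorem inner_indicator (x : V) (f : W.ell2) : ⟪W.indicator x, f⟫_ℂ = (W.m x : ℂ) * f x := by
  let _ : MeasurableSpace V := ⊤
  have hs : MeasurableSet ({x} : Set V) := trivial
  refine (L2.inner_indicatorConstLp_one hs (W.measure_singleton_ne_top x) f).trans ?_
  rw [integral_singleton, measureReal_def, W.measure_singleton,
    ENNReal.toReal_ofReal (W.m_pos x).le, Complex.real_smul]

theorem m_ne_zero (x : V) : (W.m x : ℂ) ≠ 0 := Complex.ofReal_ne_zero.2 (W.m_pos x).ne'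

theorem norm_indicator_sq (x : V) : ‖W.indicator x‖ ^ 2 = W.m x := by
  have h := inner_self_eq_norm_sq_to_K (𝕜 := ℂ) (W.indicator x)
  rw [W.inner_indicator, W.indicator_apply, if_pos rfl, mul_one] at h
  exact Complex.ofReal_injective (by rw [Complex.ofReal_pow]; exact h.symm)

instance : Nontrivial W.ell2 := by
  refine ⟨W.indicator W.root, 0, fun h => (W.m_pos W.root).ne' ?_⟩
  rw [← W.norm_indicator_sq, h, norm_zero, zero_pow two_ne_zero]

/-- Evaluation at a vertex. -/
def eval (x : V) : W.ell2 →L[ℂ] ℂ := (W.m x : ℂ)⁻¹ • innerSL ℂ (W.indicator x)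

theorem eval_apply (x : V) (f : W.ell2) : W.eval x f = f x := by
  simp [eval, W.inner_indicator, inv_mul_cancel_left₀ (W.m_ne_zero x)]

theorem dense_span_indicator : Dense (Submodule.span ℂ (Set.range W.indicator) : Set W.ell2) := by
  rw [Submodule.dense_iff_topologicalClosure_eq_top, Submodule.topologicalClosure_eq_top_iff,
    Submodule.eq_bot_iff]
  intro f hf
  refine W.ext fun x => ?_
  have h := (Submodule.mem_orthogonal _ _).1 hf _ (Submodule.subset_span ⟨x, rfl⟩)
  rw [W.inner_indicator] at h
  rw [W.coe_zero]
  exact (mul_eq_zero.1 h).resolve_left (W.m_ne_zero x)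

theorem P_indicator_apply (x y : V) : W.P (W.indicator y) x = W.p x y := by
  classical
  rw [W.P_apply, tsum_eq_single y]
  · simp [W.indicator_apply]
  · intro w hw
    simp [W.indicator_apply, hw]

/-- `P` is self-adjoint. -/
theorem isSymmetric_P : (W.P : W.ell2 →ₗ[ℂ] W.ell2).IsSymmetric := by
  rw [← ContinuousLinearMap.isSelfAdjoint_iff_isSymmetric,
    ContinuousLinearMap.isSelfAdjoint_iff']
  refine ContinuousLinearMap.ext_on W.dense_span_indicator ?_
  rintro _ ⟨y, rfl⟩
  refine W.ext fun x => mul_left_cancel₀ (W.m_ne_zero x) ?_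
  rw [← W.inner_indicator, ContinuousLinearMap.adjoint_inner_right, ← inner_conj_symm,
    W.inner_indicator, W.P_indicator_apply, W.P_indicator_apply, map_mul, Complex.conj_ofReal,
    Complex.conj_ofReal]
  exact_mod_cast W.m_mul_p y x

theorem norm_P_le_one : ‖W.P‖ ≤ 1 := LinearMap.mkContinuous_norm_le _ zero_le_one _

theorem P_pow_indicator_apply (n : ℕ) (x y : V) :
    (W.P ^ n) (W.indicator y) x = W.stepProb n x y := by
  classical
  induction n generalizing x with
  | zero =>
    rw [pow_zero, one_apply_eq_self, W.indicator_apply, stepProb]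
    split_ifs <;> simp
  | succ n ih =>
    rw [pow_succ', mul_apply_eq_comp, W.P_apply, stepProb, Complex.ofReal_tsum]
    simp only [ih, Complex.ofReal_mul]

theorem stepProb_nonneg (n : ℕ) (x y : V) : 0 ≤ W.stepProb n x y := by
  induction n generalizing x with
  | zero => rw [stepProb]; split_ifs <;> norm_num
  | succ n ih => exact tsum_nonneg fun w => mul_nonneg (W.p_nonneg x w) (ih w)

theorem norm_P_pow_indicator_sq (n : ℕ) (x : V) :
    ‖(W.P ^ n) (W.indicator x)‖ ^ 2 = W.m x * W.stepProb (n + n) x x := by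
  have h1 : ⟪(W.P ^ n) (W.indicator x), (W.P ^ n) (W.indicator x)⟫_ℂ
      = ⟪W.indicator x, (W.P ^ n) ((W.P ^ n) (W.indicator x))⟫_ℂ := by
    have h := W.isSymmetric_P.pow n (W.indicator x) ((W.P ^ n) (W.indicator x))
    rw [← ContinuousLinearMap.toLinearMap_pow] at h
    exact h
  rw [← mul_apply_eq_comp, ← pow_add, W.inner_indicator, W.P_pow_indicator_apply,
    inner_self_eq_norm_sq_to_K] at h1
  exact Complex.ofReal_injective (by rw [Complex.ofReal_pow, Complex.ofReal_mul]; exact h1)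

/-- Cauchy–Schwarz and `‖P‖ ≤ 1`. It supplies the boundedness without which a real `limsup` carries
no information. -/
theorem stepProb_self_le_one (n : ℕ) (x : V) : W.stepProb n x x ≤ 1 := by
  have h : ‖⟪W.indicator x, (W.P ^ n) (W.indicator x)⟫_ℂ‖ ≤ W.m x := by
    calc _ ≤ ‖W.indicator x‖ * ‖(W.P ^ n) (W.indicator x)‖ := norm_inner_le_norm _ _
      _ ≤ ‖W.indicator x‖ * (1 * ‖W.indicator x‖) := by
        gcongr
        refine (W.P ^ n).le_of_opNorm_le ?_ _
        exact (norm_pow_le _ n).trans (pow_le_one₀ (norm_nonneg _) W.norm_P_le_one)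
      _ = W.m x := by rw [← W.norm_indicator_sq]; ring
  rw [W.inner_indicator, W.P_pow_indicator_apply, norm_mul, Complex.norm_real, Complex.norm_real,
    Real.norm_of_nonneg (W.m_pos x).le, Real.norm_of_nonneg (W.stepProb_nonneg n x x)] at h
  exact le_of_mul_le_mul_left (by simpa using h) (W.m_pos x)

theorem eventually_stepProb_root_le {r : ℝ} (hr : W.rho < r) :
    0 < r ∧ ∀ᶠ n in atTop, W.stepProb n W.root W.root ≤ r ^ n := by
  have hbdd : IsBoundedUnder (· ≤ ·) atTop
      fun n : ℕ => W.stepProb n W.root W.root ^ (1 / (n : ℝ)) :=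
    isBoundedUnder_of ⟨1, fun n => Real.rpow_le_one (W.stepProb_nonneg _ _ _)
      (W.stepProb_self_le_one _ _) (by positivity)⟩
  have h := eventually_lt_of_limsup_lt hr hbdd
  obtain ⟨n, hn⟩ := h.exists
  refine ⟨(Real.rpow_nonneg (W.stepProb_nonneg _ _ _) _).trans_lt hn, ?_⟩
  filter_upwards [h, eventually_ne_atTop 0] with n hn h0
  rw [← Real.rpow_inv_natCast_pow (W.stepProb_nonneg n W.root W.root) h0, ← one_div]
  exact pow_le_pow_left₀ (Real.rpow_nonneg (W.stepProb_nonneg _ _ _) _) hn.le n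

variable {W} {Γ : Subgroup (W.tree ≃g W.tree)}

theorem IsTransitivelyInvariant.stepProb_eq (hΓ : W.IsTransitivelyInvariant Γ)
    {γ : W.tree ≃g W.tree} (hγ : γ ∈ Γ) (n : ℕ) (x y : V) :
    W.stepProb n (γ x) (γ y) = W.stepProb n x y := by
  induction n generalizing x with
  | zero =>
    have h : γ x = γ y ↔ x = y := γ.injective.eq_iff
    by_cases hxy : x = y
    · simp [stepProb, hxy]
    · rw [stepProb, stepProb, if_neg hxy, if_neg (mt h.1 hxy)]
  | succ n ih =>
    rw [stepProb, stepProb, ← γ.toEquiv.tsum_eq]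
    exact tsum_congr fun w => congrArg₂ _ (hΓ.invariant γ hγ x w) (ih w)

theorem IsTransitivelyInvariant.stepProb_self_eq (hΓ : W.IsTransitivelyInvariant Γ)
    (n : ℕ) (x : V) : W.stepProb n x x = W.stepProb n W.root W.root := by
  obtain ⟨γ, hγ, rfl⟩ := hΓ.transitive W.root x
  exact hΓ.stepProb_eq hγ n _ _

/-- For `r > ρ`, `‖Pⁿ 1ₓ‖² = m(x) p⁽²ⁿ⁾(x,x)` is eventually at most `m(x) r²ⁿ`, by transitivity.
Finite combinations inherit this growth rate with some constant, log-convexity removes the constant,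
and density finishes. -/
theorem IsTransitivelyInvariant.norm_P_le (hΓ : W.IsTransitivelyInvariant Γ) : ‖W.P‖ ≤ W.rho := by
  refine le_of_forall_gt_imp_ge_of_dense fun r hr => ?_
  obtain ⟨hr0, hr⟩ := W.eventually_stepProb_root_le hr
  refine W.P.opNorm_le_bound hr0.le fun f => ?_
  refine W.dense_span_indicator.induction (P := fun f => ‖W.P f‖ ≤ r * ‖f‖) ?_
    (isClosed_le (by fun_prop) (by fun_prop)) f
  intro f hf
  obtain ⟨C, hC⟩ : ∃ C, ∀ᶠ n : ℕ in atTop, ‖(W.P ^ n) f‖ ≤ C * r ^ n := by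
    induction hf using Submodule.span_induction with
    | mem f hf =>
      obtain ⟨x, rfl⟩ := hf
      refine ⟨‖W.indicator x‖, ?_⟩
      filter_upwards [tendsto_id.atTop_add_atTop tendsto_id |>.eventually hr] with n hn
      refine le_of_sq_le_sq ?_ (by positivity)
      rw [W.norm_P_pow_indicator_sq, mul_pow, W.norm_indicator_sq, hΓ.stepProb_self_eq, ← pow_mul,
        mul_two]
      exact mul_le_mul_of_nonneg_left hn (W.m_pos x).le
    | zero => exact ⟨0, by simp⟩
    | add f g _ _ hf hg =>
      obtain ⟨C, hC⟩ := hf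
      obtain ⟨D, hD⟩ := hg
      refine ⟨C + D, ?_⟩
      filter_upwards [hC, hD] with n h1 h2
      rw [map_add, add_mul]
      exact (norm_add_le _ _).trans (add_le_add h1 h2)
    | smul c f _ hf =>
      obtain ⟨C, hC⟩ := hf
      refine ⟨‖c‖ * C, ?_⟩
      filter_upwards [hC] with n h
      rw [map_smul, norm_smul, mul_assoc]
      gcongr
  exact W.isSymmetric_P.norm_apply_le_of_eventually hr0 hC

end TreeWalk
end

/-! ### The Green function on the diagonal. -/

noncomputable section
namespace TreeWalk
open scoped InnerProductSpace
open Filter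

variable {V : Type*} (W : TreeWalk V)

variable {W} in
theorem sub_P_resolvent {z : ℂ} (hz : z ∈ W.res) (f : W.ell2) :
    z • resolvent W.P z f - W.P (resolvent W.P z f) = f := by
  have h : (algebraMap ℂ (W.ell2 →L[ℂ] W.ell2) z - W.P) * resolvent W.P z = 1 :=
    Ring.mul_inverse_cancel _ hz
  exact congrArg (fun T : W.ell2 →L[ℂ] W.ell2 => T f) h

variable {W} in
theorem eq_resolvent {z : ℂ} (hz : z ∈ W.res) {f g : W.ell2} (h : z • g - W.P g = f) :
    g = resolvent W.P z f := by
  have h1 : resolvent W.P z * (algebraMap ℂ (W.ell2 →L[ℂ] W.ell2) z - W.P) = 1 :=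
    Ring.inverse_mul_cancel _ hz
  rw [← h]
  exact (congrArg (fun T : W.ell2 →L[ℂ] W.ell2 => T g) h1).symm

/-- The Green function is the generating function of the `n`-step transition probabilities. -/
theorem hasSum_G {z : ℂ} (hz : ‖W.P‖ < ‖z‖) (x y : V) :
    HasSum (fun n => z⁻¹ * (z⁻¹ ^ n * W.stepProb n x y)) (W.G x y z) := by
  have hz0 : z ≠ 0 := norm_pos_iff.1 ((norm_nonneg _).trans_lt hz)
  have hn : ‖z⁻¹ • W.P‖ < 1 := by
    rw [norm_smul, norm_inv, inv_mul_lt_iff₀ (norm_pos_iff.2 hz0), mul_one]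
    exact hz
  have h1 : HasSum (fun n => (z⁻¹ • W.P) ^ n) (z • resolvent W.P z) := by
    have h2 : z • resolvent W.P z = resolvent (z⁻¹ • W.P) (1 : ℂ) :=
      spectrum.units_smul_resolvent_self (r := Units.mk0 z hz0)
    rw [h2, resolvent, map_one, ← geom_series_eq_inverse _ hn]
    exact (summable_geometric_of_norm_lt_one hn).hasSum
  have h3 := (((ContinuousLinearMap.apply ℂ W.ell2 (W.indicator y)).hasSum h1).mapL
    (W.eval x)).mul_left z⁻¹
  have h4 : ∀ n, W.eval x (((z⁻¹ • W.P) ^ n) (W.indicator y)) = z⁻¹ ^ n * W.stepProb n x y := by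
    intro n
    rw [smul_pow, smul_apply, map_smul, W.eval_apply,
      W.P_pow_indicator_apply, smul_eq_mul]
  have h5 : z⁻¹ * W.eval x ((z • resolvent W.P z) (W.indicator y)) = W.G x y z := by
    rw [smul_apply, map_smul, W.eval_apply, smul_eq_mul,
      inv_mul_cancel_left₀ hz0, G]
  simpa only [ContinuousLinearMap.apply_apply, h4, h5] using h3

/-- A tree is bipartite: each step changes the colour. -/
theorem stepProb_eq_zero_of_odd {x : V} {n : ℕ} (hn : Odd n) : W.stepProb n x x = 0 := by
  obtain ⟨c⟩ := W.isTree.colorable_two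
  have key : ∀ (n : ℕ) (x y : V), ((c x).val + (c y).val + n) % 2 = 1 → W.stepProb n x y = 0 := by
    intro n
    induction n with
    | zero =>
      intro x y h
      rw [stepProb, if_neg]
      rintro rfl
      omega
    | succ n ih =>
      intro x y h
      refine (tsum_congr fun w => ?_).trans tsum_zero
      by_cases hw : W.tree.Adj x w
      · have h1 : (c x).val ≠ (c w).val := Fin.val_ne_of_ne (c.valid hw)
        rw [ih w y (by omega), mul_zero]
      · rw [W.p_eq_zero hw, zero_mul]
  obtain ⟨k, rfl⟩ := hn
  exact key _ _ _ (by omega)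

theorem G_self_neg {z : ℂ} (hz : ‖W.P‖ < ‖z‖) (x : V) : W.G x x (-z) = -W.G x x z := by
  refine (W.hasSum_G (by rwa [norm_neg]) x x).unique ?_
  refine (W.hasSum_G hz x x).neg.congr_fun fun n => ?_
  rcases n.even_or_odd with hn | hn
  · rw [inv_neg, hn.neg_pow]; ring
  · rw [W.stepProb_eq_zero_of_odd hn]; simp

theorem mem_res {z : ℂ} (hz : ‖W.P‖ < ‖z‖) : z ∈ W.res :=
  spectrum.mem_resolventSet_of_norm_lt hz

/-- The diagonal Green function expressed through `u = (z² - P²)⁻¹ 1ₓ`. -/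
theorem exists_m_mul_G {z : ℂ} (hz : ‖W.P‖ < ‖z‖) (x : V) : ∃ u : W.ell2, u ≠ 0 ∧
    (W.m x : ℂ) * W.G x x z
      = z * ((starRingEnd ℂ z) ^ 2 * (‖u‖ : ℂ) ^ 2 - (‖W.P u‖ : ℂ) ^ 2) := by
  have hz0 : z ≠ 0 := norm_pos_iff.1 ((norm_nonneg _).trans_lt hz)
  set a := resolvent W.P z (W.indicator x) with ha
  set b := resolvent W.P (-z) (W.indicator x) with hb
  have ha1 : W.P a = z • a - W.indicator x := by
    rw [← sub_P_resolvent (W.mem_res hz) (W.indicator x), ← ha]; abel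
  have hb1 : W.P b = (-z) • b - W.indicator x := by
    rw [← sub_P_resolvent (W.mem_res (z := -z) (by rwa [norm_neg])) (W.indicator x), ← hb]; abel
  -- Partial fractions for `(z² - P²)⁻¹`; `b` carries the sign of `(-z - P)⁻¹ = -(z + P)⁻¹`.
  set u := (2 * z)⁻¹ • (a - b) with hu
  have h1 : z ^ 2 • u - W.P (W.P u) = W.indicator x := by
    have h2 : W.P (W.P (a - b)) = z ^ 2 • (a - b) - (2 * z) • W.indicator x := by
      simp only [map_sub, ha1, hb1, map_smul]
      module
    rw [hu, map_smul, map_smul, h2, smul_comm (z ^ 2), ← smul_sub, sub_sub_cancel, smul_smul,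
      inv_mul_cancel₀ (by simpa using hz0), one_smul]
  -- Oddness of the diagonal Green function gives `a x - b x = 2 G(x,x|z)`.
  have h3 : W.G x x z = (z • u) x := by
    have h4 : W.G x x (-z) = b x := rfl
    have h5 : W.G x x z = a x := rfl
    rw [hu, smul_smul, W.coe_smul, Pi.smul_apply, W.coe_sub, Pi.sub_apply, ← h4, ← h5,
      W.G_self_neg hz, smul_eq_mul]
    field_simp
    ring
  refine ⟨u, ?_, ?_⟩
  · intro h0
    rw [h0] at h1
    have h6 := W.norm_indicator_sq x
    rw [← h1] at h6
    simp at h6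
    exact (W.m_pos x).ne h6
  · rw [← W.isSymmetric_P.inner_sq_sub_sq, h1, W.inner_indicator, h3]

theorem G_self_re_ne_zero {z : ℂ} (hz : ‖W.P‖ < ‖z‖) (hre : z.re ≠ 0) (x : V) :
    (W.G x x z).re ≠ 0 := by
  obtain ⟨u, hu0, hu⟩ := W.exists_m_mul_G hz x
  have hlt : ‖W.P u‖ < ‖z‖ * ‖u‖ :=
    (W.P.le_opNorm u).trans_lt (mul_lt_mul_of_pos_right hz (norm_pos_iff.2 hu0))
  have h1 : W.m x * (W.G x x z).re = z.re * ((‖z‖ * ‖u‖) ^ 2 - ‖W.P u‖ ^ 2) := by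
    have h2 := congrArg Complex.re hu
    rw [Complex.re_ofReal_mul] at h2
    rw [h2, mul_pow, Complex.sq_norm, Complex.normSq_apply]
    simp [pow_two]
    ring
  intro h0
  rw [h0, mul_zero] at h1
  refine mul_ne_zero hre ?_ h1.symm
  have := pow_lt_pow_left₀ hlt (norm_nonneg _) two_ne_zero
  linarith

/-- On the imaginary axis the resolvent of a symmetric operator has norm at most `1/|t|`; pair it
with `1ₓ` on both sides. -/
theorem norm_G_self_le {t : ℝ} (ht : Complex.I * t ∈ W.res) (ht0 : t ≠ 0) (x : V) :
    ‖W.G x x (Complex.I * t)‖ ≤ |t|⁻¹ := by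
  set v := resolvent W.P (Complex.I * t) (W.indicator x) with hv
  have h1 := W.isSymmetric_P.norm_smul_sub_sq t v
  rw [hv, sub_P_resolvent ht, ← hv, ← sq_abs t, ← mul_pow] at h1
  have h2 : |t| * ‖v‖ ≤ ‖W.indicator x‖ := le_of_sq_le_sq h1 (norm_nonneg _)
  have h3 : W.m x * ‖W.G x x (Complex.I * t)‖ ≤ ‖W.indicator x‖ * ‖v‖ := by
    have h4 := norm_inner_le_norm (𝕜 := ℂ) (W.indicator x) v
    rwa [W.inner_indicator, norm_mul, Complex.norm_real, Real.norm_of_nonneg (W.m_pos x).le] at h4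
  have ht1 : 0 < |t| := abs_pos.2 ht0
  rw [← one_div, le_div_iff₀ ht1]
  refine le_of_mul_le_mul_left ?_ (W.m_pos x)
  calc _ = |t| * (W.m x * ‖W.G x x (Complex.I * t)‖) := by ring
    _ ≤ |t| * (‖W.indicator x‖ * ‖v‖) := by gcongr
    _ = ‖W.indicator x‖ * (|t| * ‖v‖) := by ring
    _ ≤ ‖W.indicator x‖ * ‖W.indicator x‖ := by gcongr
    _ = W.m x * 1 := by rw [← W.norm_indicator_sq]; ring

/-! ### The Green function across an edge and the branch of the root. -/

/-- Deleting an edge `xy` of the tree leaves a component of `x` that is joined to the rest of the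
tree only by `xy`. -/
theorem exists_component {x y : V} (h : W.tree.Adj x y) : ∃ X : Set V, x ∈ X ∧ y ∉ X ∧
    ∀ a b, W.tree.Adj a b → a ∈ X → b ∉ X → a = x ∧ b = y := by
  have hy : ¬ (W.tree.deleteEdges {s(x, y)}).Reachable x y :=
    SimpleGraph.isBridge_iff.1
      (SimpleGraph.isAcyclic_iff_forall_adj_isBridge.1 W.isTree.isAcyclic h)
  refine ⟨{a | (W.tree.deleteEdges {s(x, y)}).Reachable x a}, SimpleGraph.Reachable.refl x, hy, ?_⟩
  intro a b hab ha hb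
  by_cases he : s(a, b) = s(x, y)
  · rcases Sym2.eq_iff.1 he with h1 | ⟨rfl, -⟩
    · exact h1
    · exact absurd ha hy
  · exact absurd (ha.trans (SimpleGraph.Adj.reachable (by simpa [hab] using he))) hb

/-- Truncate `G(·,y)` to the side `X` of the edge containing `x`. Applying `z - P` leaves only
defects at `x` and `y`, so the resolvent writes the truncation through `G(·,x)` and `G(·,y)`;
evaluate at `x`. -/
theorem G_adj_quadratic {z : ℂ} (hz : z ∈ W.res) {x y : V} (h : W.tree.Adj x y) :
    W.p y x * W.G x y z ^ 2 + W.G x y z = W.p x y * W.G x x z * W.G y y z := by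
  classical
  obtain ⟨X, hx, hy, hX⟩ := W.exists_component h
  set v := resolvent W.P z (W.indicator y) with hv
  have hL : MemLp (X.indicator (v : V → ℂ)) 2 W.measure := by
    let _ : MeasurableSpace V := ⊤
    have hs : MeasurableSet X := trivial
    exact (Lp.memLp v).indicator hs
  have hf : (hL.toLp : V → ℂ) = X.indicator v := W.eq_of_ae hL.coeFn_toLp
  have hva : ∀ a, z * v a - ∑' w, (W.p a w : ℂ) * v w = if a = y then 1 else 0 := by
    intro a
    have h1 := congrArg (fun g : W.ell2 => g a) (sub_P_resolvent hz (W.indicator y))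
    simpa only [← hv, W.coe_sub, W.coe_smul, Pi.sub_apply, Pi.smul_apply, smul_eq_mul, W.P_apply,
      W.indicator_apply] using h1
  have hxy : x ≠ y := h.ne
  have key : z • hL.toLp - W.P hL.toLp
      = (W.p x y * v y) • W.indicator x - (W.p y x * v x) • W.indicator y := by
    refine W.ext fun a => ?_
    simp only [W.coe_sub, W.coe_smul, Pi.sub_apply, Pi.smul_apply, smul_eq_mul, W.P_apply,
      W.indicator_apply, hf]
    by_cases ha : a ∈ X
    · have hay : a ≠ y := fun h' => hy (h' ▸ ha)
      have h2 := hva a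
      rw [if_neg hay] at h2
      rw [Set.indicator_of_mem ha, if_neg hay]
      by_cases hax : a = x
      · subst hax
        have h3 : ∀ w, (W.p a w : ℂ) * X.indicator v w
            = W.p a w * v w - if w = y then W.p a y * v y else 0 := by
          intro w
          by_cases hw : w ∈ X
          · rw [Set.indicator_of_mem hw, if_neg (fun h' : w = y => hy (h' ▸ hw)), sub_zero]
          · rw [Set.indicator_of_notMem hw]
            by_cases hwy : w = y
            · simp [hwy]
            · rw [W.p_eq_zero fun h' => hwy (hX a w h' ha hw).2, if_neg hwy]
              simp
        have hs : Summable fun w => if w = y then (W.p a y : ℂ) * v y else 0 :=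
          (hasSum_ite_eq y _).summable
        rw [tsum_congr h3, (W.summable_act v a).tsum_sub hs, tsum_ite_eq, if_pos rfl]
        linear_combination h2
      · rw [if_neg hax, tsum_congr (g := fun w => (W.p a w : ℂ) * v w)]
        · linear_combination h2
        · intro w
          by_cases hw : w ∈ X
          · rw [Set.indicator_of_mem hw]
          · rw [W.p_eq_zero fun h' => hax (hX a w h' ha hw).1]
            simp
    · have hax : a ≠ x := fun h' => ha (h' ▸ hx)
      rw [Set.indicator_of_notMem ha, if_neg hax, tsum_eq_single x]
      · rw [Set.indicator_of_mem hx]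
        by_cases hay : a = y
        · simp [hay]
        · rw [if_neg hay, W.p_eq_zero fun h' => hay (hX x a h'.symm hx ha).2]
          simp
      · intro w hw
        by_cases hwX : w ∈ X
        · rw [W.p_eq_zero fun h' => hw (hX w a h'.symm hwX ha).1]
          simp
        · rw [Set.indicator_of_notMem hwX, mul_zero]
  have h4 := congrArg (fun g : W.ell2 => g x) (eq_resolvent hz key)
  simp only [map_sub, map_smul, W.coe_sub, W.coe_smul, Pi.sub_apply, Pi.smul_apply, smul_eq_mul,
    hf, Set.indicator_of_mem hx, ← hv] at h4
  change W.G x y z = W.p x y * W.G y y z * W.G x x z - W.p y x * W.G x y z * W.G x y z at h4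
  linear_combination h4

theorem one_add_mul_G_sq_mem_slitPlane {z : ℂ} (hz : ‖W.P‖ < ‖z‖) {a : ℝ} (ha : 0 < a)
    (hza : z.re = 0 → 2 * √a < ‖z‖) (x : V) : 1 + 4 * a * W.G x x z ^ 2 ∈ Complex.slitPlane := by
  by_cases hre : z.re = 0
  · obtain ⟨t, rfl⟩ : ∃ t : ℝ, z = Complex.I * t := ⟨z.im, by apply Complex.ext <;> simp [hre]⟩
    have hk := hza hre
    have h0 : 0 < ‖Complex.I * t‖ := (norm_nonneg _).trans_lt hz
    simp only [norm_mul, Complex.norm_I, one_mul, Complex.norm_real, Real.norm_eq_abs] at hk h0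
    have hG := W.norm_G_self_le (W.mem_res hz) (abs_pos.1 h0) x
    set g := W.G x x (Complex.I * t)
    have h1 : 2 * √a * ‖g‖ < 1 := by
      calc 2 * √a * ‖g‖ ≤ 2 * √a * |t|⁻¹ := by gcongr
        _ < 1 := by rwa [← div_eq_mul_inv, div_lt_one h0]
    have h2 : ‖4 * (a : ℂ) * g ^ 2‖ < 1 := by
      have h3 : ‖4 * (a : ℂ) * g ^ 2‖ = (2 * √a * ‖g‖) ^ 2 := by
        rw [mul_pow, mul_pow, Real.sq_sqrt ha.le]
        simp [abs_of_pos ha]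
        norm_num
      rw [h3]
      exact pow_lt_one₀ (by positivity) h1 two_ne_zero
    left
    have h4 := (abs_lt.1 ((Complex.abs_re_le_norm _).trans_lt h2)).1
    rw [Complex.add_re, Complex.one_re]
    linarith
  · have hG := W.G_self_re_ne_zero hz hre x
    set g := W.G x x z
    -- With `g.re ≠ 0`, either the imaginary part is nonzero or `g` is real and the sum is positive.
    have h1 : 1 + 4 * (a : ℂ) * g ^ 2
        = ((1 + 4 * a * (g.re ^ 2 - g.im ^ 2) : ℝ) : ℂ) + (8 * a * g.re * g.im : ℝ) * Complex.I := by
      conv_lhs => rw [← Complex.re_add_im g]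
      push_cast
      linear_combination 4 * (a : ℂ) * (g.im : ℂ) ^ 2 * Complex.I_sq
    rw [h1, Complex.mem_slitPlane_iff, Complex.add_re, Complex.add_im, Complex.ofReal_re,
      Complex.ofReal_im, Complex.re_ofReal_mul, Complex.im_ofReal_mul, Complex.I_re, Complex.I_im,
      mul_zero, add_zero, zero_add, mul_one]
    by_cases him : g.im = 0
    · left
      rw [him, zero_pow two_ne_zero, sub_zero]
      positivity
    · right
      exact mul_ne_zero (mul_ne_zero (by positivity) hG) him

/-- A square off `(-∞,0]` means `Re φ ≠ 0`. The real part is positive near infinity, hence also at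
`1` by the intermediate value theorem, and the principal root is the one with positive real part. -/
theorem _root_.Complex.eq_sqrt_sq_of_tendsto_one {φ : ℝ → ℂ} (hc : ContinuousOn φ (Set.Ici 1))
    (hφ : ∀ s, 1 ≤ s → φ s ^ 2 ∈ Complex.slitPlane) (ht : Tendsto φ atTop (nhds 1)) :
    φ 1 = Complex.sqrt (φ 1 ^ 2) := by
  have hre : ∀ s, 1 ≤ s → (φ s).re ≠ 0 := by
    intro s hs h0
    have h1 := hφ s hs
    rw [Complex.mem_slitPlane_iff] at h1
    simp only [pow_two, Complex.mul_re, Complex.mul_im, h0] at h1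
    rcases h1 with h1 | h1
    · nlinarith [mul_self_nonneg (φ s).im]
    · simp at h1
  have hpos : 0 < (φ 1).re := by
    by_contra! hneg
    have ht' := (Complex.continuous_re.tendsto 1).comp ht
    rw [Complex.one_re] at ht'
    obtain ⟨s, hs0, hs⟩ := ((ht'.eventually (lt_mem_nhds one_pos)).and (eventually_ge_atTop 1)).exists
    have hs0 : 0 < (φ s).re := hs0
    obtain ⟨c, hc1, hc2⟩ := intermediate_value_Icc hs
      (Complex.continuous_re.comp_continuousOn (hc.mono Set.Icc_subset_Ici_self)) ⟨hneg, hs0.le⟩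
    exact hre c hc1.1 hc2
  rw [Complex.sqrt, Complex.sq_cpow_two_inv hpos]

theorem continuousAt_G {z : ℂ} (hz : z ∈ W.res) (x y : V) : ContinuousAt (W.G x y) z := by
  have h1 : ContinuousAt (resolvent W.P) z :=
    (spectrum.hasDerivAt_resolvent_const_left hz).continuousAt
  have h2 : W.G x y = fun w => W.eval x (resolvent W.P w (W.indicator y)) := by
    funext w; rw [W.eval_apply, G]
  rw [h2]
  exact (W.eval x).continuous.continuousAt.comp (h1.clm_apply continuousAt_const)

theorem tendsto_G_cobounded (x y : V) :
    Tendsto (W.G x y) (Bornology.cobounded ℂ) (nhds 0) := by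
  have h1 := spectrum.resolvent_tendsto_cobounded (𝕜 := ℂ) W.P
  have h2 : W.G x y = fun w => W.eval x (resolvent W.P w (W.indicator y)) := by
    funext w; rw [W.eval_apply, G]
  rw [h2]
  have h3 := ((W.eval x ∘L ContinuousLinearMap.apply ℂ W.ell2 (W.indicator y)).continuous.tendsto
    0).comp h1
  rwa [map_zero] at h3

theorem G_adj_eq {z : ℂ} (hz : ‖W.P‖ < ‖z‖) {x y : V} (h : W.tree.Adj x y)
    (hza : z.re = 0 → 2 * √(W.p x y * W.p y x) < ‖z‖)
    (hxy : ∀ w : ℂ, ‖W.P‖ < ‖w‖ → W.G y y w = W.G x x w) :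
    W.G x y z = (Complex.sqrt (1 + 4 * (W.p x y : ℂ) * (W.p y x : ℂ) * W.G x x z ^ 2) - 1)
      / (2 * (W.p y x : ℂ)) := by
  have hp : 0 < W.p x y * W.p y x := mul_pos (W.p_pos h) (W.p_pos h.symm)
  have hz0 : 0 < ‖z‖ := (norm_nonneg _).trans_lt hz
  have hscale : ∀ s : ℝ, 1 ≤ s → ‖z‖ ≤ ‖(s : ℂ) * z‖ := by
    intro s hs
    rw [norm_mul, Complex.norm_real, Real.norm_of_nonneg (by linarith)]
    exact le_mul_of_one_le_left hz0.le hs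
  -- Completing the square in the quadratic relation, multiplied by `4 p(y,x)`.
  have hsq : ∀ s : ℝ, 1 ≤ s → (1 + 2 * W.p y x * W.G x y (s * z)) ^ 2
      = 1 + 4 * (W.p x y : ℂ) * W.p y x * W.G x x (s * z) ^ 2 := by
    intro s hs
    have hn := hz.trans_le (hscale s hs)
    have hq := W.G_adj_quadratic (W.mem_res hn) h
    rw [hxy _ hn] at hq
    linear_combination 4 * (W.p y x : ℂ) * hq
  have hφ := Complex.eq_sqrt_sq_of_tendsto_one
    (φ := fun s : ℝ => 1 + 2 * W.p y x * W.G x y (s * z)) ?_ ?_ ?_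
  · have h1 := hsq 1 le_rfl
    simp only [Complex.ofReal_one, one_mul] at h1 hφ
    rw [h1] at hφ
    have h2 : (2 * W.p y x : ℂ) ≠ 0 := by
      simpa using (W.p_pos h.symm).ne'
    rw [eq_div_iff h2, ← hφ]
    ring
  · intro s hs
    have h1 := W.continuousAt_G (W.mem_res (hz.trans_le (hscale s hs))) x y
    have h2 : ContinuousAt (fun s : ℝ => W.G x y (s * z)) s :=
      ContinuousAt.comp (f := fun s : ℝ => (s : ℂ) * z) h1 (by fun_prop)
    exact (continuousAt_const.add (continuousAt_const.mul h2)).continuousWithinAt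
  · intro s hs
    simp only [hsq s hs]
    have h1 := W.one_add_mul_G_sq_mem_slitPlane (hz.trans_le (hscale s hs)) hp
      (fun h0 => (hza ?_).trans_le (hscale s hs)) x
    · simpa only [Complex.ofReal_mul, mul_assoc] using h1
    · rw [Complex.re_ofReal_mul] at h0
      exact (mul_eq_zero.1 h0).resolve_left (by linarith)
  · have h1 : Tendsto (fun s : ℝ => (s : ℂ) * z) atTop (Bornology.cobounded ℂ) := by
      rw [← tendsto_norm_atTop_iff_cobounded]
      simp only [norm_mul, Complex.norm_real]
      exact tendsto_norm_atTop_atTop.atTop_mul_const hz0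
    simpa using ((W.tendsto_G_cobounded x y).comp h1).const_mul (2 * W.p y x : ℂ) |>.const_add 1

end TreeWalk
end

/-! ### Invariance under the group, edge types and `κ`. -/

noncomputable section
namespace TreeWalk
open Filter

variable {V : Type*} {W : TreeWalk V} {Γ : Subgroup (W.tree ≃g W.tree)}

theorem IsTransitivelyInvariant.G_eq (hΓ : W.IsTransitivelyInvariant Γ)
    {γ : W.tree ≃g W.tree} (hγ : γ ∈ Γ) {z : ℂ} (hz : ‖W.P‖ < ‖z‖) (x y : V) :
    W.G (γ x) (γ y) z = W.G x y z := by
  refine (W.hasSum_G hz (γ x) (γ y)).unique ?_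
  simpa only [hΓ.stepProb_eq hγ] using W.hasSum_G hz x y

theorem IsTransitivelyInvariant.G_self_eq (hΓ : W.IsTransitivelyInvariant Γ)
    {z : ℂ} (hz : ‖W.P‖ < ‖z‖) (x y : V) : W.G x x z = W.G y y z := by
  obtain ⟨γ, hγ, rfl⟩ := hΓ.transitive y x
  exact hΓ.G_eq hγ hz y y

theorem p_le_one (x y : V) : W.p x y ≤ 1 :=
  le_hasSum (W.hasSum_p x) y fun w _ => W.p_nonneg x w

theorem EdgeType.exists_root_edge (hΓ : W.IsTransitivelyInvariant Γ) (j : W.EdgeType Γ) :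
    ∃ e : W.tree.Dart, e.fst = W.root ∧ edgeType Γ e = j := by
  obtain ⟨e, rfl⟩ := Quotient.exists_rep j
  obtain ⟨γ, hγ, h⟩ := hΓ.transitive e.fst W.root
  have hadj : W.tree.Adj (γ e.fst) (γ e.snd) := γ.map_adj_iff.2 e.adj
  refine ⟨⟨(γ e.fst, γ e.snd), hadj⟩, h, ?_⟩
  exact Quotient.sound' ((W.edgeSetoid Γ).symm ⟨γ, hγ, rfl, rfl⟩)

/-- Representatives starting at the root have distinct endpoints for distinct types, so the `p_j`
form a subfamily of a row of `p`. -/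
theorem EdgeType.summable_prob (hΓ : W.IsTransitivelyInvariant Γ) :
    Summable fun j : W.EdgeType Γ => j.prob hΓ := by
  choose e he1 he2 using fun j : W.EdgeType Γ => j.exists_root_edge hΓ
  have hinj : Function.Injective fun j => (e j).snd := by
    intro i j hij
    rw [← he2 i, ← he2 j]
    exact congrArg _ (SimpleGraph.Dart.ext _ _ (Prod.ext ((he1 i).trans (he1 j).symm) hij))
  refine ((W.hasSum_p W.root).summable.comp_injective hinj).congr fun j => ?_
  conv_rhs => rw [← he2 j]
  rw [Function.comp_apply, ← he1 j]
  rfl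

theorem EdgeType.prob_pos (hΓ : W.IsTransitivelyInvariant Γ) (j : W.EdgeType Γ) :
    0 < j.prob hΓ := by
  obtain ⟨e, rfl⟩ := Quotient.exists_rep j
  exact W.p_pos e.adj

theorem EdgeType.prob_le_one (hΓ : W.IsTransitivelyInvariant Γ) (j : W.EdgeType Γ) :
    j.prob hΓ ≤ 1 := by
  obtain ⟨e, rfl⟩ := Quotient.exists_rep j
  exact p_le_one _ _

theorem isGreatest_kappa (hΓ : W.IsTransitivelyInvariant Γ) [Nonempty (W.EdgeType Γ)] :
    IsGreatest (Set.range fun j : W.EdgeType Γ => 2 * √(j.prob hΓ * j.neg.prob hΓ))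
      (kappa hΓ) := by
  set f := fun j : W.EdgeType Γ => 2 * √(j.prob hΓ * j.neg.prob hΓ) with hf
  have ht : Tendsto f cofinite (nhds 0) := by
    have h1 : Tendsto (fun j : W.EdgeType Γ => 2 * √(j.prob hΓ)) cofinite (nhds 0) := by
      simpa using (EdgeType.summable_prob hΓ).tendsto_cofinite_zero.sqrt.const_mul 2
    refine squeeze_zero (fun j => by positivity) (fun j => ?_) h1
    have := mul_le_of_le_one_right (j.prob_pos hΓ).le (j.neg.prob_le_one hΓ)
    simp only [hf]
    gcongr
  obtain ⟨i⟩ := ‹Nonempty (W.EdgeType Γ)›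
  have hi : 0 < f i :=
    mul_pos two_pos (Real.sqrt_pos.2 (mul_pos (i.prob_pos hΓ) (i.neg.prob_pos hΓ)))
  -- Since `f → 0` and `f i > 0`, only finitely many types compete with `i`; the best of them is the
  -- global maximum.
  have hfin : {j | ¬ f j < f i}.Finite := ht.eventually (gt_mem_nhds hi)
  obtain ⟨k, hk, hmax⟩ := Set.exists_max_image _ f hfin ⟨i, lt_irrefl _⟩
  have hg : IsGreatest (Set.range f) (f k) := by
    refine ⟨⟨k, rfl⟩, ?_⟩
    rintro _ ⟨j, rfl⟩
    by_cases hj : f j < f i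
    · exact hj.le.trans (not_lt.1 hk)
    · exact hmax j hj
  have h2 : kappa hΓ = f k := hg.csSup_eq
  rwa [h2]

theorem lt_norm_of_mem_regionU {hΓ : W.IsTransitivelyInvariant Γ} {z : ℂ}
    (hz : z ∈ regionU hΓ) (hre : z.re = 0) : kappa hΓ < ‖z‖ := by
  by_contra! hle
  refine hz.2 ⟨‖z‖, hz.1, hle, ?_⟩
  have h1 : z = Complex.I * z.im := by apply Complex.ext <;> simp [hre]
  have h2 : ‖z‖ = |z.im| := by rw [h1]; simp
  rw [h2]
  rcases abs_choice z.im with h | h <;> rw [h]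
  · exact Or.inl h1
  · right
    rw [Complex.ofReal_neg, mul_neg, neg_neg]
    exact h1

end TreeWalk
end

theorem proposition5p1 {V : Type*} (W : TreeWalk V) (Γ : Subgroup (W.tree ≃g W.tree))
    (hΓ : W.IsTransitivelyInvariant Γ)
    (hdeg : ∀ x, 3 ≤ (W.tree.neighborSet x).encard)
    (hsum : Summable fun j : W.EdgeType Γ => (j.mult : ℝ) * j.neg.prob hΓ) :
    -- the maximum defining `κ` is attained
    IsGreatest (Set.range fun j : W.EdgeType Γ => 2 * √(j.prob hΓ * j.neg.prob hΓ))
      (TreeWalk.kappa hΓ) ∧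
    ∀ z ∈ TreeWalk.regionU hΓ,
      -- the Green function is defined at `z`
      z ∈ W.res ∧
      -- `G(z)` is the common value of `G(o,o|z)` over all vertices `o`, and `G_j(z)` is the
      -- common value of `G(x,y|z)` over all oriented edges `(x,y)` of type `j`
      ∃ (G : ℂ) (Gj : W.EdgeType Γ → ℂ), (∀ o, W.G o o z = G) ∧
        (∀ e : W.tree.Dart, W.G e.fst e.snd z = Gj (TreeWalk.edgeType Γ e)) ∧
        ∀ j : W.EdgeType Γ,
          -- the argument of the root lies in the domain of the principal branch
          1 + 4 * (j.prob hΓ : ℂ) * (j.neg.prob hΓ : ℂ) * G ^ 2 ∈ Complex.slitPlane ∧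
          Gj j = (Complex.sqrt (1 + 4 * (j.prob hΓ : ℂ) * (j.neg.prob hΓ : ℂ) * G ^ 2) - 1)
            / (2 * (j.neg.prob hΓ : ℂ)) := by
  -- The degree bound gives the root a neighbour, so `κ` is a supremum over a nonempty set.
  have hne : Nonempty (W.EdgeType Γ) := by
    have h1 : (W.tree.neighborSet W.root).Nonempty := by
      rw [← Set.encard_ne_zero]
      intro h0
      have h3 := hdeg W.root
      rw [h0] at h3
      simp at h3
    obtain ⟨y, hy⟩ := h1
    exact ⟨TreeWalk.edgeType Γ ⟨(W.root, y), hy⟩⟩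
  have hκ := TreeWalk.isGreatest_kappa hΓ
  refine ⟨hκ, fun z hz => ?_⟩
  have hzP : ‖W.P‖ < ‖z‖ := hΓ.norm_P_le.trans_lt hz.1
  have hinv : ∀ e e' : W.tree.Dart, (W.edgeSetoid Γ).r e e' →
      W.G e.fst e.snd z = W.G e'.fst e'.snd z := by
    rintro e e' ⟨γ, hγ, h1, h2⟩
    rw [← h1, ← h2, hΓ.G_eq hγ hzP]
  refine ⟨W.mem_res hzP, W.G W.root W.root z, Quotient.lift (s := W.edgeSetoid Γ) _ hinv,
    fun o => hΓ.G_self_eq hzP _ _, fun e => rfl, fun j => ?_⟩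
  obtain ⟨e, rfl⟩ := Quotient.exists_rep j
  have hlt : z.re = 0 → 2 * √(W.p e.fst e.snd * W.p e.snd e.fst) < ‖z‖ := fun h0 =>
    (hκ.2 ⟨TreeWalk.edgeType Γ e, rfl⟩ : 2 * √(W.p e.fst e.snd * W.p e.snd e.fst) ≤ _).trans_lt
      (TreeWalk.lt_norm_of_mem_regionU hz h0)
  rw [hΓ.G_self_eq hzP W.root e.fst]
  constructor
  · have h1 := W.one_add_mul_G_sq_mem_slitPlane hzP
      (mul_pos (W.p_pos e.adj) (W.p_pos e.adj.symm)) hlt e.fst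
    rw [Complex.ofReal_mul, ← mul_assoc] at h1
    exact h1
  · exact W.G_adj_eq hzP e.adj hlt fun w hw => hΓ.G_self_eq hw _ _
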